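/- Let $G$ be a nonempty finite simple $6$-regular graph embedded in the torus, the embedding being described combinatorially by its rotation system, that is, by a cyclic ordering of the edges around each vertex such that the sum of the genera of the connected components of $G$ (computed from the Euler characteristics $V-E+F$ of the components, $F$ counting facial walks) is at most $1$. Then the embedding is a triangulation of the torus ($G$ is connected, $V-E+F=0$, and every facial walk is a $3$-cycle), and it has a Grünbaum coloring: the edges of $G$ can be colored with three colors so that the three edges of every facial triangle receive three different colors. -/

import Mathlib

namespace SimpleGraph

/-- An embedding of the simple graph `G` in an oriented closed surface, given by its rotation system:
the permutation `next` sends a dart (an oriented edge) to the dart that follows it in the cyclic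
order around their common initial vertex. The darts that start at any one vertex form one cycle. -/
structure RotationSystem {V : Type*} (G : SimpleGraph V) where
  /-- the dart that follows in the cyclic order around the initial vertex -/
  next : Equiv.Perm G.Dart
  /-- the orbits of `next` are exactly the sets of darts with a common initial vertex -/
  sameCycle_iff : ∀ d e : G.Dart, next.SameCycle d e ↔ d.fst = e.fst

namespace RotationSystem

variable {V : Type*} {G : SimpleGraph V}

/-- Tracing of faces: having traversed the dart `d`, the facial walk goes on with the dart that
follows the reverse of `d` in the rotation at the end of `d`. The orbits are the facial walks. -/
def faceNext (R : G.RotationSystem) : Equiv.Perm G.Dart :=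
  (Function.Involutive.toPerm Dart.symm Dart.symm_involutive).trans R.next

/-- The number of facial walks; an isolated vertex has one facial walk, of length `0`. -/
noncomputable def numFaces (R : G.RotationSystem) : ℕ :=
  Nat.card (Quotient (Equiv.Perm.SameCycle.setoid R.faceNext)) +
    Nat.card {v : V // ∀ w, ¬ G.Adj v w}

/-- Twice the total genus, `2c - (V - E + F)` with `c` the number of connected components: the sum
over the components of `2 - χ`, where `χ` is the Euler characteristic of the surface obtained
by gluing a disc to every facial walk of the component. -/
noncomputable def eulerGenus (R : G.RotationSystem) : ℤ :=
  2 * (Nat.card G.ConnectedComponent : ℤ) -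
    ((Nat.card V : ℤ) - (Nat.card G.edgeSet : ℤ) + (R.numFaces : ℤ))

/-- `R` describes an embedding (2-cell or not, of a connected graph or not) in the torus:
the total genus is at most `1`. -/
def IsToroidal (R : G.RotationSystem) : Prop :=
  R.eulerGenus ≤ 2

/-- `R` describes a triangulation of the torus: the graph is connected, the surface obtained by
gluing a disc to every facial walk is the torus (genus exactly `1`), and every facial walk is
a triangle. (In a simple graph a closed walk of length `3` is a 3-cycle.) -/
def IsTorusTriangulation (R : G.RotationSystem) : Prop :=
  G.Connected ∧ R.eulerGenus = 2 ∧ ∀ d : G.Dart, Function.minimalPeriod R.faceNext d = 3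

/-- A Grünbaum coloring of a triangulation: a 3-coloring of the edges such that the three edges
of every facial triangle get three different colors. -/
def IsGrunbaumColoring (R : G.RotationSystem) (c : G.edgeSet → Fin 3) : Prop :=
  ∀ d : G.Dart,
    c ⟨d.edge, d.edge_mem⟩ ≠ c ⟨(R.faceNext d).edge, (R.faceNext d).edge_mem⟩ ∧
    c ⟨(R.faceNext d).edge, (R.faceNext d).edge_mem⟩ ≠
      c ⟨(R.faceNext (R.faceNext d)).edge, (R.faceNext (R.faceNext d)).edge_mem⟩ ∧
    c ⟨d.edge, d.edge_mem⟩ ≠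
      c ⟨(R.faceNext (R.faceNext d)).edge, (R.faceNext (R.faceNext d)).edge_mem⟩

end RotationSystem

end SimpleGraph

/-! Counting darts gives `6V = 2E ≥ 3F`, with equality only if all faces are triangles. Hence `V - E
+ F ≤ 0`, and total genus at most `1` forces one component and triangular faces
(`isTorusTriangulation_of_isRegularOfDegree_six`).

Then the rotation `x` and the reversal `s` of darts satisfy `x ^ 6 = s ^ 2 = (x * s) ^ 3 = 1`, so
the triangle group `Δ(2,3,6)` of the triangular lattice acts transitively on darts. Each of its
elements is a translation times a power of `x`. The exponent mod `3` is the direction of an edge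
line. It is well defined on darts because no rotation of order `3` fixes a dart
(`exists_zmod_three_direction`). Coloring edges by direction gives the three sides of a triangle
different colors. -/

/-! ### Translations and rotations in the triangle group -/

section TriangleGroup

variable {Γ : Type*} [Group Γ] {x s : Γ}

/-- Elements of the translation lattice of a quotient of the triangle group `Δ(2,3,6)`, whose
generators are a rotation `x` of order `6` about a vertex and a rotation `s` of order `2` about the
midpoint of an edge at this vertex. -/
def latticeTranslation (x s : Γ) (i j : ℤ) : Γ :=
  (x ^ 3 * s) ^ i * (x * (x ^ 3 * s) * x⁻¹) ^ j

theorem involution_mul_rotation_mul_involution (hs : s * s = 1)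
    (h3 : x * s * (x * s) * (x * s) = 1) : s * x * s = x⁻¹ * s * x⁻¹ := by
  have hs' : s⁻¹ = s := inv_eq_of_mul_eq_one_right hs
  have h : s * x * s = x⁻¹ * (x * s * (x * s) * (x * s)) * (s⁻¹ * x⁻¹) := by group
  rw [h, h3, hs', mul_one, mul_assoc]

theorem conj_conj_translation_mul (hs : s * s = 1) (h3 : x * s * (x * s) * (x * s) = 1) :
    x * (x * (x ^ 3 * s) * x⁻¹) * x⁻¹ * (x ^ 3 * s) = x * (x ^ 3 * s) * x⁻¹ := by
  calc _ = x ^ 5 * (s * x * s) := by group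
    _ = _ := by rw [involution_mul_rotation_mul_involution hs h3]; group

/-- In the triangular lattice, the unit vectors at 0° and 120° add up to the one at 60°. -/
theorem translation_mul_conj_conj (hx : x ^ 6 = 1) (hs : s * s = 1)
    (h3 : x * s * (x * s) * (x * s) = 1) :
    x ^ 3 * s * (x * (x * (x ^ 3 * s) * x⁻¹) * x⁻¹) = x * (x ^ 3 * s) * x⁻¹ := by
  have hs' : s⁻¹ = s := inv_eq_of_mul_eq_one_right hs
  have h : s * x⁻¹ * s = x * s * x := by
    have h := congrArg (·⁻¹) (involution_mul_rotation_mul_involution hs h3)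
    simpa only [mul_inv_rev, hs', inv_inv, mul_assoc] using h
  calc _ = x ^ 3 * s * x ^ 6 * x⁻¹ * s * x⁻¹ * x⁻¹ := by group
    _ = x ^ 3 * (s * x⁻¹ * s) * x⁻¹ * x⁻¹ := by rw [hx]; group
    _ = _ := by rw [h]; group

/-- The 60° translation is the product of the 0° and 120° ones in either order, so it commutes with
the first factor. -/
theorem commute_translation_conj (hx : x ^ 6 = 1) (hs : s * s = 1)
    (h3 : x * s * (x * s) * (x * s) = 1) :
    Commute (x ^ 3 * s) (x * (x ^ 3 * s) * x⁻¹) := by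
  have h₁ := conj_conj_translation_mul hs h3
  have h₂ := translation_mul_conj_conj hx hs h3
  generalize x * (x * (x ^ 3 * s) * x⁻¹) * x⁻¹ = c at h₁ h₂
  rw [← h₁]
  exact SemiconjBy.mul_right (h₂.trans h₁.symm) (Commute.refl _)

theorem latticeTranslation_mul (hx : x ^ 6 = 1) (hs : s * s = 1)
    (h3 : x * s * (x * s) * (x * s) = 1) (i j k l : ℤ) :
    latticeTranslation x s i j * latticeTranslation x s k l =
      latticeTranslation x s (i + k) (j + l) := by
  have h := ((commute_translation_conj hx hs h3).zpow_zpow k j).eq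
  simp only [latticeTranslation, zpow_add]
  rw [mul_assoc, ← mul_assoc _ (_ ^ k), ← h]
  simp only [mul_assoc]

/-- Conjugation by `x` is the 60° turn of the lattice: it sends the basis `t, u` to `u, u - t`. -/
theorem mul_latticeTranslation (hx : x ^ 6 = 1) (hs : s * s = 1)
    (h3 : x * s * (x * s) * (x * s) = 1) (i j : ℤ) :
    x * latticeTranslation x s i j = latticeTranslation x s (-j) (i + j) * x := by
  have hc := commute_translation_conj hx hs h3
  have h : x * (x * (x ^ 3 * s) * x⁻¹) * x⁻¹ =
      (x ^ 3 * s)⁻¹ * (x * (x ^ 3 * s) * x⁻¹) := by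
    rw [eq_inv_mul_iff_mul_eq, translation_mul_conj_conj hx hs h3]
  have h' : x * latticeTranslation x s i j * x⁻¹ = latticeTranslation x s (-j) (i + j) := by
    calc _ = (x * (x ^ 3 * s) * x⁻¹) ^ i * (x * (x * (x ^ 3 * s) * x⁻¹) * x⁻¹) ^ j := by
          rw [conj_zpow (i := i), conj_zpow (i := j), latticeTranslation]
          group
      _ = _ := by
          rw [h, hc.inv_left.mul_zpow, ← mul_assoc, inv_zpow', latticeTranslation, zpow_add,
            (hc.zpow_zpow (-j) i).symm.eq, mul_assoc]
  rw [← h', inv_mul_cancel_right]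

theorem exists_pow_mul_latticeTranslation (hx : x ^ 6 = 1) (hs : s * s = 1)
    (h3 : x * s * (x * s) * (x * s) = 1) (m : ℕ) (i j : ℤ) :
    ∃ k l, x ^ m * latticeTranslation x s i j = latticeTranslation x s k l * x ^ m := by
  induction m with
  | zero => exact ⟨i, j, by simp⟩
  | succ m ih =>
    obtain ⟨k, l, h⟩ := ih
    refine ⟨-l, k + l, ?_⟩
    rw [pow_succ', mul_assoc, h, ← mul_assoc, mul_latticeTranslation hx hs h3, mul_assoc]

/-- Here `s` is the half turn `x ^ 3` times a translation, and a half turn negates the lattice. -/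
theorem involution_mul_latticeTranslation (hx : x ^ 6 = 1) (hs : s * s = 1)
    (h3 : x * s * (x * s) * (x * s) = 1) (i j : ℤ) :
    s * latticeTranslation x s i j = latticeTranslation x s (-i - 1) (-j) * x ^ 3 := by
  have h : s = x ^ 3 * latticeTranslation x s 1 0 := by
    have : x ^ 3 * (x ^ 3 * s) = x ^ 6 * s := by group
    simp [latticeTranslation, this, hx]
  have h' : ∀ k l, x ^ 3 * latticeTranslation x s k l = latticeTranslation x s (-k) (-l) * x ^ 3 := by
    intro k l
    have h3x : x ^ 3 = x * (x * x) := by rw [pow_succ', pow_two]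
    have h₁ := mul_latticeTranslation hx hs h3
    rw [h3x, mul_assoc, mul_assoc, h₁, ← mul_assoc x _ x, h₁, mul_assoc, ← mul_assoc x, h₁,
      mul_assoc]
    congr 2 <;> ring
  calc _ = x ^ 3 * latticeTranslation x s 1 0 * latticeTranslation x s i j := by rw [← h]
    _ = _ := by
      rw [mul_assoc, latticeTranslation_mul hx hs h3, h']
      congr 2 <;> ring

end TriangleGroup

/-! ### Stabilizers and the direction of a dart -/

section FixedPoints

open Equiv

variable {α : Type*} {x s : Perm α}

/-- Conjugation by translations preserves only `p - q` mod `3`. The three classes are the 120°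
rotations about vertices and about the two kinds of triangles. A fixed dart contradicts `hfix` in
the first class and `hne` in the others. -/
theorem latticeTranslation_mul_sq_apply_ne (hx : x ^ 6 = 1) (hs : s * s = 1)
    (h3 : x * s * (x * s) * (x * s) = 1) (hfix : ∀ d, (x ^ 2) d ≠ d) (hne : ∀ d, s d ≠ x d)
    (p q : ℤ) (d : α) : (latticeTranslation x s p q * x ^ 2) d ≠ d := by
  intro hd
  have hconj : ∀ i j, (latticeTranslation x s (p + 2 * i + j) (q + j - i) * x ^ 2)
      (latticeTranslation x s i j d) = latticeTranslation x s i j d := by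
    intro i j
    have h : latticeTranslation x s (p + 2 * i + j) (q + j - i) * x ^ 2 *
        latticeTranslation x s i j =
        latticeTranslation x s i j * (latticeTranslation x s p q * x ^ 2) := by
      rw [pow_two, mul_assoc, mul_assoc, mul_latticeTranslation hx hs h3, ← mul_assoc x,
        mul_latticeTranslation hx hs h3, ← mul_assoc, ← mul_assoc, ← mul_assoc,
        latticeTranslation_mul hx hs h3, ← mul_assoc, latticeTranslation_mul hx hs h3]
      congr 3 <;> ring
    rw [← Perm.mul_apply, h, Perm.mul_apply, hd]
  -- With `j = i - q` below, the second coordinate vanishes and the first becomes `p - q + 3 * i`.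
  obtain ⟨i, hi⟩ : ∃ i, p - q + 3 * i = 0 ∨ p - q + 3 * i = 1 ∨ p - q + 3 * i = -1 :=
    ⟨-((p - q + 1) / 3), by omega⟩
  have h := hconj i (i - q)
  rw [show p + 2 * i + (i - q) = p - q + 3 * i by ring, show q + (i - q) - i = 0 by ring] at h
  generalize latticeTranslation x s i (i - q) d = e at h
  have hx1 : ∀ e, x (x (x (x (x (x e))))) = e := fun e => DFunLike.congr_fun hx e
  have hs1 : ∀ e, s (s e) = e := fun e => DFunLike.congr_fun hs e
  rcases hi with hi | hi | hi
  · rw [hi] at h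
    exact hfix e (by simpa [latticeTranslation] using h)
  · rw [hi] at h
    have h' : x (x (x (s (x (x e))))) = e := by
      simpa [latticeTranslation, pow_succ] using h
    refine hne (x (x e)) ?_
    have := congrArg (fun e => x (x (x e))) h'
    simpa [hx1] using this
  · rw [hi] at h
    have h' : x (x e) = x (x (x (s e))) := by
      have := congrArg (fun e => (x ^ 3 * s : Perm α) e) h
      simpa [latticeTranslation, pow_succ] using this
    refine hne (s e) ?_
    rw [hs1]
    exact x.injective (x.injective h')

theorem three_dvd_of_latticeTranslation_mul_pow_apply_eq (hx : x ^ 6 = 1) (hs : s * s = 1)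
    (h3 : x * s * (x * s) * (x * s) = 1) (hfix : ∀ d, (x ^ 2) d ≠ d) (hne : ∀ d, s d ≠ x d)
    {p q : ℤ} {m : ℕ} {d : α} (h : (latticeTranslation x s p q * x ^ m) d = d) : 3 ∣ m := by
  have hdouble : ∀ n : ℕ, (∃ i j, (latticeTranslation x s i j * x ^ n) d = d) →
      ∃ i j, (latticeTranslation x s i j * x ^ (2 * n)) d = d := by
    rintro n ⟨i, j, h⟩
    obtain ⟨k, l, hkl⟩ := exists_pow_mul_latticeTranslation hx hs h3 n i j
    refine ⟨i + k, j + l, ?_⟩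
    have : latticeTranslation x s (i + k) (j + l) * x ^ (2 * n) =
        latticeTranslation x s i j * x ^ n * (latticeTranslation x s i j * x ^ n) := by
      rw [← mul_assoc, mul_assoc _ (x ^ n), hkl, ← latticeTranslation_mul hx hs h3, two_mul,
        pow_add]
      simp only [mul_assoc]
    rw [this, Perm.mul_apply, h, h]
  have hmod : ∀ n : ℕ, n % 6 = 2 → ¬ ∃ i j, (latticeTranslation x s i j * x ^ n) d = d := by
    rintro n hn ⟨i, j, h⟩
    rw [pow_eq_pow_mod n hx, hn] at h
    exact latticeTranslation_mul_sq_apply_ne hx hs h3 hfix hne i j d h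
  have h₁ : ∃ i j, (latticeTranslation x s i j * x ^ m) d = d := ⟨p, q, h⟩
  -- If `3 ∤ m`, one of `m`, `2m`, `4m` is `2` mod `6`.
  have h₂ := hdouble m h₁
  have h₄ := hdouble _ h₂
  have n₁ := mt (hmod m) (not_not.mpr h₁)
  have n₂ := mt (hmod _) (not_not.mpr h₂)
  have n₄ := mt (hmod _) (not_not.mpr h₄)
  omega

/-- A transitive action of the triangle group `Δ(2,3,6)` whose rotations act freely has a function
to `ZMod 3` that grows by one under `x` and is invariant under `s`: the direction of edges. -/
theorem exists_zmod_three_direction (hx : x ^ 6 = 1) (hs : s * s = 1)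
    (h3 : x * s * (x * s) * (x * s) = 1) (hfix : ∀ d, (x ^ 2) d ≠ d) (hne : ∀ d, s d ≠ x d)
    (d₀ : α) (htrans : ∀ P : α → Prop, P d₀ → (∀ d, P d → P (x d)) → (∀ d, P d → P (s d)) →
      ∀ d, P d) :
    ∃ c : α → ZMod 3, ∀ d, c (x d) = c d + 1 ∧ c (s d) = c d := by
  have hex : ∀ d, ∃ k : ℕ, ∃ i j, (latticeTranslation x s i j * x ^ k) d₀ = d := by
    refine htrans _ ⟨0, 0, 0, by simp [latticeTranslation]⟩ ?_ ?_
    · rintro d ⟨k, i, j, h⟩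
      refine ⟨k + 1, -j, i + j, ?_⟩
      rw [← h, ← Perm.mul_apply, ← mul_assoc, mul_latticeTranslation hx hs h3, pow_succ',
        mul_assoc]
    · rintro d ⟨k, i, j, h⟩
      refine ⟨3 + k, -i - 1, -j, ?_⟩
      rw [← h, ← Perm.mul_apply, ← mul_assoc, involution_mul_latticeTranslation hx hs h3, pow_add,
        mul_assoc]
  have huniq : ∀ (k k' : ℕ) (i j i' j' : ℤ), (latticeTranslation x s i j * x ^ k) d₀ =
      (latticeTranslation x s i' j' * x ^ k') d₀ → (k : ZMod 3) = k' := by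
    intro k k' i j i' j' h
    -- The factor `x ^ (5 * k)` is the inverse of `x ^ k`, and `5 ≡ -1` mod `3`.
    have h' : (latticeTranslation x s (i' - i) (j' - j) * x ^ (k' + 5 * k)) ((x ^ k) d₀) =
        (x ^ k) d₀ := by
      have h₁ : latticeTranslation x s i j *
          (latticeTranslation x s (i' - i) (j' - j) * x ^ (k' + 5 * k) * x ^ k) =
          latticeTranslation x s i' j' * x ^ k' := by
        rw [mul_assoc, ← mul_assoc, latticeTranslation_mul hx hs h3, ← pow_add,
          show k' + 5 * k + k = k' + 6 * k by ring, pow_add, pow_mul x 6, hx, one_pow, mul_one]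
        congr 2 <;> ring
      apply (latticeTranslation x s i j).injective
      rw [← Perm.mul_apply, ← Perm.mul_apply, mul_assoc, h₁, ← h, Perm.mul_apply]
    have := three_dvd_of_latticeTranslation_mul_pow_apply_eq hx hs h3 hfix hne h'
    rw [ZMod.natCast_eq_natCast_iff']
    omega
  choose c i j hc using hex
  refine ⟨fun d => c d, fun d => ⟨?_, ?_⟩⟩
  · have := huniq (c (x d)) (c d + 1) (i (x d)) (j (x d)) (-j d) (i d + j d) (by
      rw [hc, pow_succ', ← mul_assoc, ← mul_latticeTranslation hx hs h3, mul_assoc,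
        Perm.mul_apply, hc])
    simpa using this
  · have := huniq (c (s d)) (3 + c d) (i (s d)) (j (s d)) (-i d - 1) (-j d) (by
      rw [hc, pow_add, ← mul_assoc, ← involution_mul_latticeTranslation hx hs h3, mul_assoc,
        Perm.mul_apply, hc])
    have h0 : (3 : ZMod 3) = 0 := rfl
    simpa [h0] using this

end FixedPoints

namespace SimpleGraph

namespace RotationSystem

open Function Equiv

/-! ### Rotations and faces in a regular graph -/

section Regular

variable {V : Type*} {G : SimpleGraph V} (R : G.RotationSystem)

theorem next_fst (d : G.Dart) : (R.next d).fst = d.fst :=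
  ((R.sameCycle_iff d (R.next d)).1 (Perm.sameCycle_apply_right.2 (Perm.SameCycle.refl _ _))).symm

theorem faceNext_fst (d : G.Dart) : (R.faceNext d).fst = d.snd := R.next_fst d.symm

theorem faceNext_ne (d : G.Dart) : R.faceNext d ≠ d := fun h =>
  G.ne_of_adj d.adj ((congrArg (·.fst) h).symm.trans (R.faceNext_fst d))

theorem minimalPeriod_next [Fintype V] [G.LocallyFinite] (d : G.Dart) :
    minimalPeriod R.next d = G.degree d.fst := by
  classical
  have h := MulAction.minimalPeriod_eq_card R.next d
  have horb : MulAction.orbit (Subgroup.zpowers R.next) d = {e | e.fst = d.fst} := by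
    ext e
    rw [Set.mem_ofPred_eq, eq_comm, ← R.sameCycle_iff d e]
    constructor
    · rintro ⟨⟨_, n, rfl⟩, hn⟩
      exact ⟨n, hn⟩
    · rintro ⟨n, hn⟩
      exact ⟨⟨_, n, rfl⟩, hn⟩
  have hcard := G.dart_fst_fiber_card_eq_degree d.fst
  have hdeg : {e : G.Dart | e.fst = d.fst}.ncard = G.degree d.fst := by
    rw [Set.ncard_eq_toFinset_card', Set.toFinset_ofPred, hcard]
    congr!
  rw [← hdeg, ← horb, ← Nat.card_coe_set_eq, Nat.card_eq_fintype_card]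
  exact h

variable [Fintype V] [G.LocallyFinite]

theorem next_pow_eq_one {n : ℕ} (hreg : G.IsRegularOfDegree n) : R.next ^ n = 1 := by
  ext1 d
  rw [← Perm.iterate_eq_pow, ← hreg d.fst, ← R.minimalPeriod_next d]
  exact isPeriodicPt_minimalPeriod _ _

theorem next_pow_apply_ne {n k : ℕ} (hreg : G.IsRegularOfDegree n) (hk : ¬ n ∣ k) (d : G.Dart) :
    (R.next ^ k) d ≠ d := by
  intro h
  rw [← Perm.iterate_eq_pow] at h
  have := IsPeriodicPt.minimalPeriod_dvd h
  rw [R.minimalPeriod_next, hreg] at this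
  exact hk this

theorem faceNext_faceNext_ne {n : ℕ} (hreg : G.IsRegularOfDegree n) (hn : 2 ≤ n) (d : G.Dart) :
    R.faceNext (R.faceNext d) ≠ d := by
  intro h
  have h₁ : R.faceNext d = d.symm := by
    apply Dart.ext
    apply Prod.ext
    · exact R.faceNext_fst d
    · rw [← R.faceNext_fst (R.faceNext d), h]
      rfl
  refine R.next_pow_apply_ne (k := 1) hreg (fun h => ?_) d.symm ?_
  · have := Nat.le_of_dvd one_pos h
    omega
  · rw [pow_one]
    exact h₁

end Regular

/-! ### Euler characteristic -/

section Counting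

variable {V : Type*} [Fintype V] {G : SimpleGraph V} [G.LocallyFinite] (R : G.RotationSystem)

open Classical in
theorem three_le_card_face {n : ℕ} (hreg : G.IsRegularOfDegree n) (hn : 2 ≤ n) (d : G.Dart) :
    {e ∈ (Finset.univ : Finset G.Dart) | R.faceNext.SameCycle d e}.card ≥ 3 ∧
    ({e ∈ (Finset.univ : Finset G.Dart) | R.faceNext.SameCycle d e}.card = 3 →
      R.faceNext (R.faceNext (R.faceNext d)) = d) := by
  have h₁ := R.faceNext_ne d
  have h₁' := R.faceNext_ne (R.faceNext d)
  have h₂ := R.faceNext_faceNext_ne hreg hn d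
  have hsub : ({d, R.faceNext d, R.faceNext (R.faceNext d)} : Finset G.Dart) ⊆
      {e ∈ (Finset.univ : Finset G.Dart) | R.faceNext.SameCycle d e} := by
    intro e he
    simp only [Finset.mem_insert, Finset.mem_singleton] at he
    rcases he with rfl | rfl | rfl <;> simp [Perm.SameCycle.refl]
  have hcard : ({d, R.faceNext d, R.faceNext (R.faceNext d)} : Finset G.Dart).card = 3 :=
    Finset.card_eq_three.2 ⟨_, _, _, h₁.symm, h₂.symm, h₁'.symm, rfl⟩
  refine ⟨hcard ▸ Finset.card_le_card hsub, fun h => ?_⟩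
  have heq := Finset.eq_of_subset_of_card_le hsub (by omega)
  have hmem : R.faceNext (R.faceNext (R.faceNext d)) ∈
      ({d, R.faceNext d, R.faceNext (R.faceNext d)} : Finset G.Dart) := by
    rw [heq]
    simp [Perm.SameCycle.refl]
  simp only [Finset.mem_insert, Finset.mem_singleton] at hmem
  rcases hmem with h | h | h
  · exact h
  · exact absurd (R.faceNext.injective h) h₂
  · exact absurd h (R.faceNext_ne _)

theorem card_faces_mul_three_le {n : ℕ} (hreg : G.IsRegularOfDegree n) (hn : 2 ≤ n) :
    Nat.card (Quotient (Perm.SameCycle.setoid R.faceNext)) * 3 ≤ Nat.card G.Dart ∧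
    (Nat.card (Quotient (Perm.SameCycle.setoid R.faceNext)) * 3 = Nat.card G.Dart →
      ∀ d, R.faceNext (R.faceNext (R.faceNext d)) = d) := by
  classical
  have hfib : ∀ d : G.Dart, {e ∈ (Finset.univ : Finset G.Dart) |
      Quotient.mk (Perm.SameCycle.setoid R.faceNext) e =
        Quotient.mk (Perm.SameCycle.setoid R.faceNext) d} =
      {e ∈ (Finset.univ : Finset G.Dart) | R.faceNext.SameCycle d e} := by
    intro d
    ext e
    simp only [Finset.mem_filter_univ, Quotient.eq]
    exact Perm.sameCycle_comm
  have hle : ∀ q ∈ (Finset.univ : Finset (Quotient (Perm.SameCycle.setoid R.faceNext))),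
      3 ≤ {e ∈ (Finset.univ : Finset G.Dart) |
      Quotient.mk (Perm.SameCycle.setoid R.faceNext) e = q}.card := by
    intro q _
    induction q using Quotient.inductionOn with
    | h d =>
      rw [hfib]
      exact (R.three_le_card_face hreg hn d).1
  have hsum := Finset.card_eq_sum_card_fiberwise
    (f := fun e : G.Dart => Quotient.mk (Perm.SameCycle.setoid R.faceNext) e)
    (s := Finset.univ) (t := Finset.univ) (fun _ _ => Finset.mem_coe.2 (Finset.mem_univ _))
  have hconst : Nat.card (Quotient (Perm.SameCycle.setoid R.faceNext)) * 3 =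
      ∑ _q : Quotient (Perm.SameCycle.setoid R.faceNext), 3 := by
    simp [Nat.card_eq_fintype_card]
  rw [hconst, Nat.card_eq_fintype_card, ← Finset.card_univ, hsum]
  refine ⟨Finset.sum_le_sum hle, fun h d => ?_⟩
  have := (Finset.sum_eq_sum_iff_of_le hle).1 h (Quotient.mk _ d) (Finset.mem_univ _)
  rw [hfib] at this
  exact (R.three_le_card_face hreg hn d).2 this.symm

theorem card_dart_of_isRegularOfDegree {n : ℕ} (hreg : G.IsRegularOfDegree n) :
    Nat.card G.Dart = n * Nat.card V ∧ Nat.card G.Dart = 2 * Nat.card G.edgeSet := by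
  classical
  rw [Nat.card_eq_fintype_card, Nat.card_eq_fintype_card, Nat.card_eq_fintype_card]
  constructor
  · rw [dart_card_eq_sum_degrees, Finset.sum_congr rfl (g := fun _ => n), Finset.sum_const,
      Finset.card_univ, smul_eq_mul, mul_comm]
    intro v _
    rw [← hreg v]
    congr!
  · rw [dart_card_eq_twice_card_edges, edgeFinset_card]

omit [Fintype V] in
theorem numFaces_eq_of_isRegularOfDegree {n : ℕ} (hreg : G.IsRegularOfDegree n) (hn : n ≠ 0) :
    R.numFaces = Nat.card (Quotient (Perm.SameCycle.setoid R.faceNext)) := by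
  have : IsEmpty {v : V // ∀ w, ¬ G.Adj v w} := by
    refine ⟨fun ⟨v, hv⟩ => ?_⟩
    obtain ⟨w, hw⟩ := (G.degree_pos_iff_exists_adj v).1 (by rw [hreg v]; omega)
    exact hv w hw
  rw [numFaces, Nat.card_of_isEmpty (α := {v : V // ∀ w, ¬ G.Adj v w}), add_zero]

theorem isTorusTriangulation_of_isRegularOfDegree_six [Nonempty V]
    (hreg : G.IsRegularOfDegree 6) (hR : R.IsToroidal) : R.IsTorusTriangulation := by
  obtain ⟨hle, heq⟩ := R.card_faces_mul_three_le hreg (by norm_num)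
  obtain ⟨hV, hE⟩ := card_dart_of_isRegularOfDegree hreg
  have hF := R.numFaces_eq_of_isRegularOfDegree hreg (by norm_num)
  have hc : 0 < Nat.card G.ConnectedComponent := Nat.card_pos
  unfold IsToroidal at hR
  have hg := hR
  unfold eulerGenus at hR
  rw [hF] at hR
  refine ⟨?_, ?_, ?_⟩
  -- With `c` components, the Euler genus is at least `2c`, so its bound `2` leaves only `c = 1`.
  · have h1 : Nat.card G.ConnectedComponent = 1 := by omega
    have hsub := (Nat.card_eq_one_iff_unique.1 h1).1
    exact ⟨fun u v => ConnectedComponent.exact (Subsingleton.elim _ _)⟩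
  · unfold eulerGenus
    rw [hF]
    omega
  · intro d
    exact minimalPeriod_eq_prime (hp := ⟨Nat.prime_three⟩) (heq (by omega) d) (R.faceNext_ne d)

end Counting

/-! ### Transitivity on darts and the coloring -/

theorem dart_induction {V : Type*} [Finite V] {G : SimpleGraph V} (R : G.RotationSystem)
    (hconn : G.Connected) (P : G.Dart → Prop) (d₀ : G.Dart) (h₀ : P d₀)
    (hnext : ∀ d, P d → P (R.next d)) (hsymm : ∀ d, P d → P d.symm) (d : G.Dart) : P d := by
  classical
  have := Fintype.ofFinite V
  have hcyc : ∀ d e : G.Dart, d.fst = e.fst → P d → P e := by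
    intro d e hde hd
    obtain ⟨n, rfl⟩ := ((R.sameCycle_iff d e).2 hde).exists_nat_pow_eq
    clear hde
    induction n with
    | zero => exact hd
    | succ n ih =>
      rw [pow_succ', Perm.mul_apply]
      exact hnext _ ih
  have hwalk : ∀ (u v : V), G.Reachable u v → (∃ e : G.Dart, e.fst = u ∧ P e) →
      ∃ e : G.Dart, e.fst = v ∧ P e := by
    rintro u v ⟨p⟩
    induction p with
    | nil => exact id
    | cons h p ih =>
      rintro ⟨e, rfl, he⟩
      exact ih ⟨(⟨(_, _), h⟩ : G.Dart).symm, rfl, hsymm _ (hcyc e _ rfl he)⟩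
  obtain ⟨e, he, hP⟩ := hwalk _ _ (hconn.preconnected d₀.fst d.fst) ⟨d₀, rfl, h₀⟩
  exact hcyc e d he hP

/-- In a connected `6`-regular triangulation, colour the edges by direction: the colours of
opposite edges at a vertex agree. -/
theorem exists_isGrunbaumColoring {V : Type*} [Fintype V] {G : SimpleGraph V} [G.LocallyFinite]
    (R : G.RotationSystem) (hreg : G.IsRegularOfDegree 6) (hconn : G.Connected)
    (hface : ∀ d, R.faceNext (R.faceNext (R.faceNext d)) = d) :
    ∃ c : G.edgeSet → Fin 3, R.IsGrunbaumColoring c := by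
  obtain ⟨v⟩ := hconn.nonempty
  obtain ⟨w, hw⟩ := (G.degree_pos_iff_exists_adj v).1 (by rw [hreg v]; norm_num)
  obtain ⟨f, hf⟩ := exists_zmod_three_direction (x := R.next)
    (s := Involutive.toPerm Dart.symm Dart.symm_involutive) (R.next_pow_eq_one hreg)
    (Equiv.ext Dart.symm_symm) (Equiv.ext hface)
    (R.next_pow_apply_ne hreg (by norm_num))
    (fun d h => d.snd_ne_fst ((congrArg (·.fst) h).trans (R.next_fst d))) ⟨(v, w), hw⟩
    (fun P h₀ hx hs d => R.dart_induction hconn P _ h₀ hx hs d)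
  have hedge : ∀ e : G.edgeSet, ∃ d : G.Dart, d.edge = e := by
    rintro ⟨e, he⟩
    induction e using Sym2.ind with
    | h u v => exact ⟨⟨(u, v), he⟩, rfl⟩
  choose g hg using hedge
  -- Invariance of `f` under reversal makes the choice of dart `g e` irrelevant.
  have hfg : ∀ d : G.Dart, f (g ⟨d.edge, d.edge_mem⟩) = f d := by
    intro d
    rcases (dart_edge_eq_iff _ _).1 (hg ⟨d.edge, d.edge_mem⟩) with h | h
    · rw [h]
    · rw [h]
      exact (hf d).2
  -- A face step is a reversal, which keeps the direction, followed by one rotation, which adds `1`.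
  have hstep : ∀ d, f (R.faceNext d) = f d + 1 := fun d =>
    (hf d.symm).1.trans (congrArg (· + 1) (hf d).2)
  have hne : ∀ a : ZMod 3, a ≠ a + 1 ∧ a + 1 ≠ a + 1 + 1 ∧ a ≠ a + 1 + 1 := by decide
  refine ⟨fun e => f (g e), fun d => ?_⟩
  have h := hne (f d)
  rw [← hstep, ← hstep, ← hfg d, ← hfg (R.faceNext d), ← hfg (R.faceNext (R.faceNext d))] at h
  exact h

end RotationSystem

end SimpleGraph

theorem lemma3 {V : Type*} [Fintype V] [Nonempty V] (G : SimpleGraph V) [G.LocallyFinite]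
    (hreg : G.IsRegularOfDegree 6) (R : G.RotationSystem) (hR : R.IsToroidal) :
    R.IsTorusTriangulation ∧ ∃ c : G.edgeSet → Fin 3, R.IsGrunbaumColoring c := by
  have h := R.isTorusTriangulation_of_isRegularOfDegree_six hreg hR
  refine ⟨h, R.exists_isGrunbaumColoring hreg h.1 fun d => ?_⟩
  have h3 := Function.isPeriodicPt_minimalPeriod R.faceNext d
  rwa [h.2.2 d] at h3
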